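/- Let $V$ be a vector space over $GF(2)$ of dimension $\omega$ (that is, $\aleph_0$), let $A_1$ be a finite subspace of $V$, and let $\mathcal{K}$ be the family of all finite subspaces of $V$ that contain $A_1$. For $A, C \in \mathcal{K}$ let $\binom{C}{A}$ be the set of all $A' \in \mathcal{K}$ with $A' \le C$ and $A' \cong A$ (as vector spaces; since all members of $\mathcal{K}$ are finite and contain $A_1$, it is equivalent to ask for an isomorphism that fixes $A_1$ pointwise). Then $\mathcal{K}$ has the Ramsey property: for every $k \in \omega$ and all $A, B \in \mathcal{K}$ with $A \le B$ there is $C \in \mathcal{K}$ such that for every coloring $\xi : \binom{C}{A} \to \{0, \dots, k-1\}$ there is $B' \in \binom{C}{B}$ for which $\xi$ is constant on $\binom{B'}{A}$. -/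

import Mathlib

namespace SubspaceRamsey

/-- The set of copies of `A` in `C`: the members `A'` of the family `K` that are subspaces of `C`
and are isomorphic to `A`. -/
def copies {F V : Type*} [Field F] [AddCommGroup V] [Module F V]
    (K : Set (Submodule F V)) (A C : Submodule F V) : Set (Submodule F V) :=
  {A' | A' ∈ K ∧ A' ≤ C ∧ Nonempty (A ≃ₗ[F] A')}

/-- The arrow `C → (B)^A_k` in the family `K`: for every `k`-coloring of the copies of `A` in `C`
there is a copy `B'` of `B` in `C` such that all copies of `A` in `B'` have the same color. -/
def Arrow {F V : Type*} [Field F] [AddCommGroup V] [Module F V]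
    (K : Set (Submodule F V)) (A B C : Submodule F V) (k : ℕ) : Prop :=
  ∀ ξ : copies K A C → Fin k,
    ∃ B' ∈ copies K B C, ∃ c : Fin k, ∀ A' : copies K A C, A'.1 ∈ copies K A B' → ξ A' = c

/-- The Ramsey property of a family `K` of subspaces of a vector space. -/
def HasRamseyProperty {F V : Type*} [Field F] [AddCommGroup V] [Module F V]
    (K : Set (Submodule F V)) : Prop :=
  ∀ (k : ℕ), ∀ A ∈ K, ∀ B ∈ K, A ≤ B → ∃ C ∈ K, Arrow K A B C k

/-- The family of all finite subspaces that contain the distinguished subspace `A₁`. -/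
def finiteSubspacesContaining {F V : Type*} [Field F] [AddCommGroup V] [Module F V]
    (A₁ : Submodule F V) : Set (Submodule F V) :=
  {U | (U : Set V).Finite ∧ A₁ ≤ U}

/-- Between members of `finiteSubspacesContaining A₁` it makes no difference whether isomorphisms
are required to respect the distinguished subspace: isomorphic members are isomorphic by a map
that fixes `A₁` pointwise. -/
theorem exists_equiv_fixing {F V : Type*} [Field F] [AddCommGroup V] [Module F V]
    {A₁ A A' : Submodule F V} (hA : A ∈ finiteSubspacesContaining A₁)
    (hA' : A' ∈ finiteSubspacesContaining A₁) (h : Nonempty (A ≃ₗ[F] A')) :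
    ∃ φ : A ≃ₗ[F] A', ∀ x : A, (x : V) ∈ A₁ → (φ x : V) = x := by
  obtain ⟨e⟩ := h
  have : Finite A := hA.1
  have : Finite A' := hA'.1
  obtain ⟨P, hP⟩ := Submodule.exists_isCompl (A₁.submoduleOf A)
  obtain ⟨Q, hQ⟩ := Submodule.exists_isCompl (A₁.submoduleOf A')
  let f : A₁.submoduleOf A ≃ₗ[F] A₁.submoduleOf A' :=
    (Submodule.submoduleOfEquivOfLe hA.2).trans (Submodule.submoduleOfEquivOfLe hA'.2).symm
  have h1 := Submodule.finrank_add_eq_of_isCompl hP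
  have h2 := Submodule.finrank_add_eq_of_isCompl hQ
  have h3 := f.finrank_eq
  have h4 := e.finrank_eq
  let g : P ≃ₗ[F] Q := LinearEquiv.ofFinrankEq _ _ (by omega)
  refine ⟨(Submodule.prodEquivOfIsCompl _ _ hP).symm.trans
    ((f.prodCongr g).trans (Submodule.prodEquivOfIsCompl _ _ hQ)), fun x hx => ?_⟩
  let y : A₁.submoduleOf A := Subtype.mk x hx
  have hx' : (Submodule.prodEquivOfIsCompl _ _ hP).symm x = (y, (0 : P)) := by
    rw [LinearEquiv.symm_apply_eq]
    simp [y]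
  simp only [LinearEquiv.trans_apply, hx', LinearEquiv.prodCongr_apply]
  simp
  rfl

end SubspaceRamsey

/-! Modulo `A₁`, copies of `A` become subspaces of one fixed dimension, so the claim reduces to the
Graham–Leeb–Rothschild theorem. That is proved by induction on the dimension `t`, and inside it on
the sum of the target dimensions `b c`. A `(t+1)`-dimensional subspace of `U × F` either contains
the vertical line, and is `T × F` with `dim T = t`, or is the graph of a functional over a
`(t+1)`-dimensional `T`. Hales–Jewett (`exists_color_graph_eq`) makes graph colors depend on `T`
alone. Induction on `t` gives the first kind one color `c`; the inner induction, with `b c` lowered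
by one, treats the second. If its color is again `c`, the vertical line restores the lost dimension.
-/

namespace SubspaceRamsey

open Module Submodule

section Ramsey

variable {F : Type*} [Field F]

/-- There is an injective linear map `E → W` under which the images of all `t`-dimensional
subspaces of `E` receive the color `c`. -/
def HasMonoCopy {W κ : Type*} [AddCommGroup W] [Module F W] (t : ℕ) (ξ : Submodule F W → κ) (c : κ)
    (E : Type*) [AddCommGroup E] [Module F E] : Prop :=
  ∃ f : E →ₗ[F] W, Function.Injective f ∧
    ∀ T : Submodule F E, finrank F T = t → ξ (T.map f) = c

theorem finrank_map_eq_of_injective {E W : Type*} [AddCommGroup E] [Module F E] [AddCommGroup W]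
    [Module F W] {f : E →ₗ[F] W} (hf : Function.Injective f) (T : Submodule F E) :
    finrank F (T.map f) = finrank F T :=
  (Submodule.equivMapOfInjective f hf T).finrank_eq.symm

theorem HasMonoCopy.of_injective {W W' κ E E' : Type*} [AddCommGroup W] [Module F W]
    [AddCommGroup W'] [Module F W'] [AddCommGroup E] [Module F E] [AddCommGroup E'] [Module F E']
    {t : ℕ} {ξ : Submodule F W' → κ} {c : κ} {g : W →ₗ[F] W'} (hg : Function.Injective g)
    {e : E' →ₗ[F] E} (he : Function.Injective e)
    (h : HasMonoCopy t (fun T : Submodule F W => ξ (T.map g)) c E) :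
    HasMonoCopy t ξ c E' := by
  obtain ⟨f, hf, hc⟩ := h
  refine ⟨g ∘ₗ f ∘ₗ e, hg.comp (hf.comp he), fun T hT => ?_⟩
  rw [Submodule.map_comp, Submodule.map_comp]
  exact hc _ ((finrank_map_eq_of_injective he T).trans hT)

/-- The Hales–Jewett theorem, applied to the alphabet of linear functionals on `U`, makes the color
of the graph of a functional over `T` depend on `T` only. -/
theorem exists_color_graph_eq [Finite F] (κ : Type*) [Finite κ] (u : ℕ) :
    ∃ n, ∀ ξ : Submodule F (Fin n → F) → κ,
      ∃ s : (Fin u → F) × F →ₗ[F] (Fin n → F), Function.Injective s ∧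
        ∃ χ : Submodule F (Fin u → F) → κ, ∀ (T : Submodule F (Fin u → F))
          (φ : (Fin u → F) →ₗ[F] F), ξ ((T.map (LinearMap.id.prod φ)).map s) = χ T := by
  classical
  have : Finite ((Fin u → F) →ₗ[F] F) :=
    Finite.of_injective (fun φ => (φ : (Fin u → F) → F)) DFunLike.coe_injective
  have : Finite (Submodule F (Fin u → F)) :=
    Finite.of_injective (fun T => (T : Set (Fin u → F))) SetLike.coe_injective
  -- The colors are functions of `T`, so a single combinatorial line serves all `T` at once.
  obtain ⟨ι, _, hι⟩ := Combinatorics.Line.exists_mono_in_high_dimension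
    ((Fin u → F) →ₗ[F] F) (Submodule F (Fin u → F) → κ)
  let e : ((Fin u → F) × (ι → F)) ≃ₗ[F] (Fin (u + Fintype.card ι) → F) :=
    LinearEquiv.ofFinrankEq _ _ (by simp)
  refine ⟨u + Fintype.card ι, fun ξ => ?_⟩
  obtain ⟨l, χ, hl⟩ := hι fun g T =>
    ξ ((T.map (LinearMap.id.prod (LinearMap.pi g))).map e.toLinearMap)
  -- `v` is the indicator of the active coordinates. Setting the last coordinate of `s` to `φ x`
  -- yields the point `l φ` of the line evaluated at `x`; an active coordinate exists, whence
  -- injectivity.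
  let v : ι → F := fun i => if l.idxFun i = none then 1 else 0
  let s : (Fin u → F) × F →ₗ[F] (Fin u → F) × (ι → F) :=
    (LinearMap.fst F _ _).prod
      (LinearMap.pi (l 0) ∘ₗ LinearMap.fst F _ _ + (LinearMap.snd F _ F).smulRight v)
  refine ⟨e.toLinearMap ∘ₗ s, e.injective.comp ?_, χ, fun T φ => ?_⟩
  · rw [← LinearMap.ker_eq_bot, LinearMap.ker_eq_bot']
    rintro ⟨x, c⟩ h
    obtain ⟨i, hi⟩ := l.proper
    have hx : x = 0 := congrArg Prod.fst h
    have hc := congrFun (congrArg Prod.snd h) i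
    subst hx
    simpa [s, v, hi] using hc
  · have hs : s ∘ₗ LinearMap.id.prod φ = LinearMap.id.prod (LinearMap.pi (l φ)) := by
      refine LinearMap.ext fun x => Prod.ext rfl (funext fun i => ?_)
      cases h : l.idxFun i <;> simp [s, v, h, Combinatorics.Line.apply_def]
    refine Eq.trans ?_ (congrFun (hl φ) T)
    beta_reduce
    rw [← hs, Submodule.map_comp, Submodule.map_comp]

/-! ### Subspaces of `E × F`: vertical ones and graphs -/

section Product

variable {E : Type*} [AddCommGroup E] [Module F E]

theorem eq_map_fst_prod_top {T : Submodule F (E × F)} (h : ((0 : E), (1 : F)) ∈ T) :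
    T = (T.map (LinearMap.fst F E F)).prod ⊤ := by
  ext ⟨x, c⟩
  simp only [Submodule.mem_prod, Submodule.mem_map, LinearMap.fst_apply, Prod.exists,
    exists_and_right, exists_eq_right, Submodule.mem_top, and_true]
  refine ⟨fun hx => ⟨c, hx⟩, fun ⟨d, hd⟩ => ?_⟩
  simpa using T.add_mem hd (T.smul_mem (c - d) h)

theorem fst_domRestrict_injective {T : Submodule F (E × F)} (h : ((0 : E), (1 : F)) ∉ T) :
    Function.Injective ((LinearMap.fst F E F).domRestrict T) := by
  rw [← LinearMap.ker_eq_bot, LinearMap.ker_eq_bot']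
  rintro ⟨⟨x, c⟩, hx⟩ h0
  have hx0 : x = 0 := h0
  subst hx0
  by_cases hc : c = 0
  · subst hc; rfl
  · exact absurd (by simpa [hc] using T.smul_mem c⁻¹ hx) h

/-- The first projection is injective on `T`; a left inverse defined on all of `E` extends the
resulting functional beyond the image of `T`. -/
theorem exists_eq_map_fst_graph {T : Submodule F (E × F)} (h : ((0 : E), (1 : F)) ∉ T) :
    ∃ φ : E →ₗ[F] F, T = (T.map (LinearMap.fst F E F)).map (LinearMap.id.prod φ) := by
  obtain ⟨g, hg⟩ := LinearMap.exists_leftInverse_of_injective _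
    (LinearMap.ker_eq_bot.2 (fst_domRestrict_injective h))
  refine ⟨LinearMap.snd F E F ∘ₗ T.subtype ∘ₗ g, ?_⟩
  rw [← Submodule.map_comp]
  conv_lhs => rw [← Submodule.map_id T]
  have key (y : T) : g (y : E × F).1 = y := LinearMap.congr_fun hg y
  refine SetLike.coe_injective (Set.image_congr fun y hy => ?_)
  have := key ⟨y, hy⟩
  ext <;> simp [this]

theorem finrank_map_fst_of_notMem {T : Submodule F (E × F)} (h : ((0 : E), (1 : F)) ∉ T) :
    finrank F (T.map (LinearMap.fst F E F)) = finrank F T := by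
  rw [← LinearMap.range_domRestrict]
  exact LinearMap.finrank_range_of_inj (fst_domRestrict_injective h)

theorem finrank_map_fst_of_mem [FiniteDimensional F E] {T : Submodule F (E × F)}
    (h : ((0 : E), (1 : F)) ∈ T) :
    finrank F (T.map (LinearMap.fst F E F)) + 1 = finrank F T := by
  conv_rhs => rw [eq_map_fst_prod_top h]
  have hrange : (T.map (LinearMap.fst F E F)).prod ⊤ =
      LinearMap.range ((T.map (LinearMap.fst F E F)).subtype.prodMap
        (LinearMap.id : F →ₗ[F] F)) := by
    rw [LinearMap.range_prodMap, Submodule.range_subtype, LinearMap.range_id]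
  rw [hrange, LinearMap.finrank_range_of_inj
    ((Submodule.injective_subtype _).prodMap Function.injective_id)]
  simp

end Product

/-- If the color of the graph of a functional depends on its domain only and the preimages of
`t`-dimensional subspaces of `E` have color `c`, then a copy of `E` that is monochromatic of color
`c` for the colors of graphs extends to a copy of `E × F`. -/
theorem HasMonoCopy.prod {W U E κ : Type*} [AddCommGroup W] [Module F W] [AddCommGroup U]
    [Module F U] [AddCommGroup E] [Module F E] [FiniteDimensional F E] {t : ℕ}
    {ξ : Submodule F W → κ} {c : κ} {s : U × F →ₗ[F] W} (hs : Function.Injective s)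
    {χ : Submodule F U → κ}
    (hχ : ∀ (T : Submodule F U) (φ : U →ₗ[F] F), ξ ((T.map (LinearMap.id.prod φ)).map s) = χ T)
    {f : E →ₗ[F] U} (hf : Function.Injective f)
    (h₁ : ∀ T : Submodule F E, finrank F T = t → ξ (((T.map f).prod ⊤).map s) = c)
    (h₂ : ∀ T : Submodule F E, finrank F T = t + 1 → χ (T.map f) = c) :
    HasMonoCopy (t + 1) ξ c (E × F) := by
  have hfst (T : Submodule F (E × F)) :
      (T.map (f.prodMap LinearMap.id)).map (LinearMap.fst F U F) =
        (T.map (LinearMap.fst F E F)).map f := by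
    rw [← Submodule.map_comp, ← Submodule.map_comp]
    rfl
  refine ⟨s ∘ₗ f.prodMap LinearMap.id, hs.comp (hf.prodMap Function.injective_id),
    fun T hT => ?_⟩
  rw [Submodule.map_comp]
  by_cases h : ((0 : E), (1 : F)) ∈ T
  · have h' : ((0 : U), (1 : F)) ∈ T.map (f.prodMap LinearMap.id) := ⟨(0, 1), h, by simp⟩
    rw [eq_map_fst_prod_top h', hfst]
    have := finrank_map_fst_of_mem h
    exact h₁ _ (by omega)
  · have h' : ((0 : U), (1 : F)) ∉ T.map (f.prodMap LinearMap.id) := by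
      rintro ⟨⟨x, d⟩, hx, hxd⟩
      simp only [LinearMap.prodMap_apply, LinearMap.id_apply, Prod.mk.injEq] at hxd
      obtain ⟨hx0, rfl⟩ := hxd
      rw [(map_eq_zero_iff f hf).1 hx0] at hx
      exact h hx
    obtain ⟨φ, hφ⟩ := exists_eq_map_fst_graph h'
    rw [hφ, hχ, hfst]
    exact h₂ _ ((finrank_map_fst_of_notMem h).trans hT)

theorem exists_injective_of_le {m n : ℕ} (h : m ≤ n) :
    ∃ g : (Fin m → F) →ₗ[F] (Fin n → F), Function.Injective g :=
  finrank_le_iff_exists_linearMap.1 (by simpa using h)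

/-- The Graham–Leeb–Rothschild theorem in its off-diagonal form. -/
theorem exists_hasMonoCopy [Finite F] (κ : Type*) [Finite κ] (t : ℕ) :
    ∀ b : κ → ℕ, ∃ n, ∀ ξ : Submodule F (Fin n → F) → κ, ∃ c,
      HasMonoCopy t ξ c (Fin (b c) → F) := by
  classical
  have := Fintype.ofFinite κ
  induction t with
  | zero =>
    intro b
    refine ⟨∑ c, b c, fun ξ => ⟨ξ ⊥, ?_⟩⟩
    obtain ⟨g, hg⟩ := exists_injective_of_le (F := F)
      (Finset.single_le_sum (fun c _ => Nat.zero_le (b c)) (Finset.mem_univ (ξ ⊥)))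
    refine ⟨g, hg, fun T hT => ?_⟩
    rw [Submodule.finrank_eq_zero.1 hT, Submodule.map_bot]
  | succ t iht =>
    intro b
    induction hN : ∑ c, b c generalizing b with
    | zero =>
      -- `ξ ⊥` only supplies an element of `κ`: the zero space has no `(t+1)`-dimensional subspace.
      refine ⟨0, fun ξ => ⟨ξ ⊥, ?_⟩⟩
      have h0 : b (ξ ⊥) = 0 := Finset.sum_eq_zero_iff.1 hN _ (Finset.mem_univ _)
      rw [h0]
      refine ⟨LinearMap.id, Function.injective_id, fun T hT => ?_⟩
      have := T.finrank_le
      simp [hT] at this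
    | succ N ihN =>
      by_cases hb : ∃ c, b c = 0
      · obtain ⟨c, hc⟩ := hb
        refine ⟨0, fun ξ => ⟨c, ?_⟩⟩
        rw [hc]
        refine ⟨LinearMap.id, Function.injective_id, fun T hT => ?_⟩
        have := T.finrank_le
        simp [hT] at this
      push Not at hb
      have hsum (c : κ) : ∑ d, Function.update b c (b c - 1) d = N := by
        have h1 := Finset.sum_update_of_mem (Finset.mem_univ c) b (b c - 1)
        have h2 := Finset.add_sum_erase _ b (Finset.mem_univ c)
        rw [Finset.sdiff_singleton_eq_erase] at h1
        have := hb c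
        omega
      choose m hm using fun c => ihN _ (hsum c)
      -- The color `c` is known only after `ξ`, so the sum leaves room for every `m c`.
      obtain ⟨u, hu⟩ := iht fun _ => ∑ c, m c
      obtain ⟨n, hn⟩ := exists_color_graph_eq (F := F) κ u
      refine ⟨n, fun ξ => ?_⟩
      obtain ⟨s, hs, χ, hχ⟩ := hn ξ
      obtain ⟨c, f, hf, hfc⟩ := hu fun T => ξ ((T.prod ⊤).map s)
      obtain ⟨g, hg⟩ := exists_injective_of_le (F := F)
        (Finset.single_le_sum (fun c _ => Nat.zero_le (m c)) (Finset.mem_univ c))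
      obtain ⟨d, f', hf', hfd⟩ := hm c fun T => χ (T.map (f ∘ₗ g))
      refine ⟨d, ?_⟩
      have hinj : Function.Injective (f ∘ₗ g ∘ₗ f') := hf.comp (hg.comp hf')
      have hfd' (T : Submodule F (Fin (Function.update b c (b c - 1) d) → F))
          (hT : finrank F T = t + 1) : χ (T.map (f ∘ₗ g ∘ₗ f')) = d := by
        refine Eq.trans ?_ (hfd T hT)
        rw [← LinearMap.comp_assoc, Submodule.map_comp]
      by_cases hdc : d = c
      · subst hdc
        have hcopy := HasMonoCopy.prod hs hχ hinj (c := d) (t := t) (fun T hT => by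
          rw [Submodule.map_comp]
          refine hfc _ ((finrank_map_eq_of_injective (f := g ∘ₗ f') (hg.comp hf') T).trans hT)) hfd'
        have e : (Fin (b d) → F) ≃ₗ[F] (Fin (Function.update b d (b d - 1) d) → F) × F :=
          LinearEquiv.ofFinrankEq _ _ (by
            have := hb d
            simp
            omega)
        exact HasMonoCopy.of_injective (g := LinearMap.id) Function.injective_id e.injective
          (by simpa using hcopy)
      -- For `d ≠ c` the target `b d` was not lowered, and the graph of the zero functional already
      -- carries the copy.
      · rw [← Function.update_of_ne hdc (b c - 1) b]
        refine ⟨s ∘ₗ LinearMap.id.prod 0 ∘ₗ f ∘ₗ g ∘ₗ f',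
          hs.comp (Function.Injective.comp (g := (LinearMap.id.prod 0 : _ →ₗ[F] _ × F))
            (fun x y hxy => congrArg Prod.fst hxy) hinj),
          fun T hT => ?_⟩
        rw [Submodule.map_comp, Submodule.map_comp, hχ]
        exact hfd' T hT

end Ramsey

/-! ### Reduction modulo `A₁` -/

section Quotient

variable {F V : Type*} [Field F] [AddCommGroup V] [Module F V]

theorem finite_comap_mkQ [Finite F] {A₁ : Submodule F V} (hA₁ : (A₁ : Set V).Finite)
    (T : Submodule F (V ⧸ A₁)) [FiniteDimensional F T] :
    ((T.comap A₁.mkQ : Submodule F V) : Set V).Finite := by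
  have : Finite A₁ := hA₁
  have : FiniteDimensional F A₁ := Module.Finite.of_finite
  have : FiniteDimensional F (T.comap A₁.mkQ) := by
    refine Module.Finite.iff_fg.2 (Submodule.fg_of_fg_map_of_fg_inf_ker A₁.mkQ ?_ ?_)
    · rw [Submodule.map_comap_eq_of_surjective A₁.mkQ_surjective]
      exact Module.Finite.iff_fg.1 inferInstance
    · rw [Submodule.ker_mkQ, inf_eq_right.2 (Submodule.le_comap_mkQ A₁ T)]
      exact Module.Finite.iff_fg.1 inferInstance
  exact Module.finite_of_finite F (M := T.comap A₁.mkQ)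

theorem finrank_map_mkQ_add_finrank {A₁ U : Submodule F V} [FiniteDimensional F U] (h : A₁ ≤ U) :
    finrank F (U.map A₁.mkQ) + finrank F A₁ = finrank F U := by
  rw [← LinearMap.finrank_range_add_finrank_ker (A₁.mkQ.domRestrict U),
    LinearMap.range_domRestrict, LinearMap.ker_domRestrict, Submodule.ker_mkQ,
    ← (Submodule.submoduleOfEquivOfLe h).finrank_eq]
  rfl

theorem comap_map_mkQ_of_le {A₁ U : Submodule F V} (h : A₁ ≤ U) :
    (U.map A₁.mkQ).comap A₁.mkQ = U := by
  rw [Submodule.comap_map_mkQ, sup_eq_right.2 h]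

theorem exists_injective_quotient (hV : Cardinal.aleph0 ≤ Module.rank F V) (A₁ : Submodule F V)
    [FiniteDimensional F A₁] (n : ℕ) :
    ∃ g : (Fin n → F) →ₗ[F] (V ⧸ A₁), Function.Injective g := by
  have hQ : Cardinal.aleph0 ≤ Module.rank F (V ⧸ A₁) := by
    by_contra! hlt
    have := Cardinal.add_lt_aleph0 hlt (Module.rank_lt_aleph0 F A₁)
    rw [Submodule.rank_quotient_add_rank] at this
    exact absurd hV this.not_ge
  obtain ⟨s, hs, hli⟩ := exists_finset_linearIndependent_of_le_rank
    ((Cardinal.natCast_lt_aleph0 (n := n)).le.trans hQ)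
  have e : (Fin n → F) ≃ₗ[F] (s → F) := LinearEquiv.ofFinrankEq _ _ (by simp [hs])
  exact ⟨Fintype.linearCombination F (fun x : s => (x : V ⧸ A₁)) ∘ₗ e.toLinearMap,
    (linearIndependent_iff_injective_fintypeLinearCombination.1 hli).comp e.injective⟩

/-- Over a finite field, the finite subspaces that contain a given finite subspace of an
infinite-dimensional space have the Ramsey property. -/
theorem hasRamseyProperty_finiteSubspacesContaining [Finite F]
    (hV : Cardinal.aleph0 ≤ Module.rank F V) {A₁ : Submodule F V} (hA₁ : (A₁ : Set V).Finite) :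
    HasRamseyProperty (finiteSubspacesContaining A₁) := by
  classical
  intro k A hA B hB hAB
  rcases k.eq_zero_or_pos with rfl | hk
  -- `A` is a copy of itself in `B`, so no coloring with zero colors exists.
  · exact ⟨B, hB, fun ξ => (ξ ⟨A, hA, hAB, ⟨LinearEquiv.refl F A⟩⟩).elim0⟩
  have : Finite A₁ := hA₁
  have : Finite A := hA.1
  have : Finite B := hB.1
  have : FiniteDimensional F A₁ := Module.Finite.of_finite
  have hdA := finrank_map_mkQ_add_finrank hA.2
  have hdB := finrank_map_mkQ_add_finrank hB.2
  obtain ⟨n, hn⟩ := exists_hasMonoCopy (F := F) (Fin k) (finrank F (A.map A₁.mkQ))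
    fun _ => finrank F (B.map A₁.mkQ)
  obtain ⟨g, hg⟩ := exists_injective_quotient hV A₁ n
  let C : Submodule F V := (LinearMap.range g).comap A₁.mkQ
  refine ⟨C, ⟨finite_comap_mkQ hA₁ _, Submodule.le_comap_mkQ _ _⟩, fun ξ => ?_⟩
  -- The default color is harmless: only preimages of genuine copies of `A` are evaluated below.
  obtain ⟨c, f, hf, hc⟩ := hn fun T =>
    if h : (T.map g).comap A₁.mkQ ∈ copies (finiteSubspacesContaining A₁) A C then ξ ⟨_, h⟩
    else ⟨0, hk⟩
  let B' : Submodule F V := (LinearMap.range (g ∘ₗ f)).comap A₁.mkQ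
  have hB' : B' ∈ finiteSubspacesContaining A₁ :=
    ⟨finite_comap_mkQ hA₁ _, Submodule.le_comap_mkQ _ _⟩
  have : Finite B' := hB'.1
  have hmapB' : B'.map A₁.mkQ = LinearMap.range (g ∘ₗ f) :=
    Submodule.map_comap_eq_of_surjective A₁.mkQ_surjective _
  have hdB' := finrank_map_mkQ_add_finrank hB'.2
  rw [hmapB', LinearMap.finrank_range_of_inj (f := g ∘ₗ f) (hg.comp hf)] at hdB'
  refine ⟨B', ⟨hB', Submodule.comap_mono (LinearMap.range_comp_le_range f g),
    ⟨LinearEquiv.ofFinrankEq _ _ ?_⟩⟩, c, fun A' hA' => ?_⟩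
  · rw [← hdB, ← hdB', finrank_fin_fun]
  obtain ⟨hA'K, hA'B', ⟨e⟩⟩ := hA'
  have : Finite A'.1 := hA'K.1
  have hdA' := finrank_map_mkQ_add_finrank hA'K.2
  -- `A' ≤ B'` puts the image of `A'` inside the range of `g ∘ₗ f`, so pulling back loses nothing.
  have hmap : ((A'.1.map A₁.mkQ).comap (g ∘ₗ f)).map (g ∘ₗ f) = A'.1.map A₁.mkQ :=
    Submodule.map_comap_eq_of_le (hmapB' ▸ Submodule.map_mono hA'B')
  have hT : finrank F ((A'.1.map A₁.mkQ).comap (g ∘ₗ f)) = finrank F (A.map A₁.mkQ) := by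
    rw [← finrank_map_eq_of_injective (f := g ∘ₗ f) (hg.comp hf), hmap]
    have := e.finrank_eq
    omega
  have hback :
      ((((A'.1.map A₁.mkQ).comap (g ∘ₗ f)).map f).map g).comap A₁.mkQ = A'.1 := by
    rw [← Submodule.map_comp, hmap, comap_map_mkQ_of_le hA'K.2]
  have hcol := hc _ hT
  simpa only [hback, Subtype.coe_eta, Subtype.coe_prop, dite_true] using hcol

end Quotient

end SubspaceRamsey

theorem mainTheorem4 {V : Type*} [AddCommGroup V] [Module (ZMod 2) V]
    (hV : Module.rank (ZMod 2) V = Cardinal.aleph0)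
    (A₁ : Submodule (ZMod 2) V) (hA₁ : (A₁ : Set V).Finite) :
    SubspaceRamsey.HasRamseyProperty (SubspaceRamsey.finiteSubspacesContaining A₁) :=
  SubspaceRamsey.hasRamseyProperty_finiteSubspacesContaining hV.ge hA₁
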